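/- Let $\alpha=(\alpha_n)_{n\ge 1}\subset(1,\infty)$ be a strictly increasing sequence with $\lim_{n\to\infty}\alpha_n=\infty$, and let $$\Lambda_0(\alpha)=\Big\{x\in\mathbb C^{\mathbb N}:\ \lim_{n\to\infty}e^{-\alpha_n/k}|x_n|=0\ \text{ for all } k\in\mathbb N\Big\}$$ be the power series space of finite type, a Fréchet space for the norms $p_k(x)=\sup_n e^{-\alpha_n/k}|x_n|$, $k\in\mathbb N=\{1,2,\dots\}$. Let $\mathsf C$ be the Cesàro operator, $(\mathsf Cx)_n=\frac{x_1+\dots+x_n}{n}$, which is a continuous linear operator on $\Lambda_0(\alpha)$. For a continuous linear operator $T$ on a locally convex Hausdorff space $X$, let $\rho(T;X)$ be the set of $\lambda\in\mathbb C$ for which $R(\lambda,T)=(\lambda I-T)^{-1}$ exists as a continuous linear operator on $X$, let $\sigma(T;X)=\mathbb C\setminus\rho(T;X)$, and let $\sigma_{pt}(T;X)$ be the set of $\lambda\in\mathbb C$ for which $\lambda I-T$ is not injective. Let $\sigma^*(T;X)$ be the complement in $\mathbb C$ of the set of those $\lambda$ for which there is $\delta>0$ such that $B(\lambda,\delta)=\{\mu\in\mathbb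 C:|\mu-\lambda|<\delta\}\subseteq\rho(T;X)$ and $\{R(\mu,T):\mu\in B(\lambda,\delta)\}$ is equicontinuous. Put $\Sigma=\{1/m: m\in\mathbb N\}$ and $\Sigma_0=\{0\}\cup\Sigma$. Suppose that $\Lambda_0(\alpha)$ is nuclear. (i) Then $\sigma(\mathsf C;\Lambda_0(\alpha))=\sigma_{pt}(\mathsf C;\Lambda_0(\alpha))=\Sigma$. (ii) If, in addition, $v(\alpha)=\inf_n(\alpha_{n+1}-\alpha_n)>0$, then $\sigma^*(\mathsf C;\Lambda_0(\alpha))=\overline{\sigma(\mathsf C;\Lambda_0(\alpha))}=\Sigma_0$. -/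

import Mathlib

open Filter Topology

/-! ### Nuclear maps and nuclear locally convex spaces -/

/-- A continuous linear map `T : X → Y` between normed spaces is nuclear if it has a representation
`T x = ∑ fₙ(x) yₙ` with `fₙ ∈ X'`, `yₙ ∈ Y` and `∑ ‖fₙ‖ ‖yₙ‖ < ∞`. -/
def IsNuclearMap {X Y : Type*} [NormedAddCommGroup X] [NormedSpace ℂ X]
    [NormedAddCommGroup Y] [NormedSpace ℂ Y] (T : X →L[ℂ] Y) : Prop :=
  ∃ (f : ℕ → X →L[ℂ] ℂ) (y : ℕ → Y),
    Summable (fun n => ‖f n‖ * ‖y n‖) ∧ ∀ x, HasSum (fun n => f n x • y n) (T x)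

/-- A copy of the vector space `E`, equipped with the topology of the single seminorm `p`. -/
def SeminormedCopy {E : Type*} [AddCommGroup E] [Module ℂ E] (_p : Seminorm ℂ E) : Type _ := E

namespace SeminormedCopy

variable {E : Type*} [AddCommGroup E] [Module ℂ E] (p q : Seminorm ℂ E)

noncomputable instance : SeminormedAddCommGroup (SeminormedCopy p) :=
  AddGroupSeminorm.toSeminormedAddCommGroup (E := E) p.toAddGroupSeminorm

instance : Module ℂ (SeminormedCopy p) := inferInstanceAs (Module ℂ E)

noncomputable instance : NormedSpace ℂ (SeminormedCopy p) where
  norm_smul_le c x := (map_smul_eq_mul p c x).le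

/-- The identity of `E`, as a contraction `(E, q) → (E, p)` for `p ≤ q`. -/
noncomputable def idMap (h : p ≤ q) : SeminormedCopy q →L[ℂ] SeminormedCopy p :=
  LinearMap.mkContinuous (LinearMap.id (R := ℂ) (M := E) : SeminormedCopy q →ₗ[ℂ] SeminormedCopy p) 1
    (fun x => by rw [one_mul]; exact h x)

end SeminormedCopy

/-- The local Banach space `E_p` of `E` at the seminorm `p`: the (Hausdorff) completion of
`(E, p)`, that is, the completion of the normed space `E / ker p`. -/
abbrev LocalBanachSpace {E : Type*} [AddCommGroup E] [Module ℂ E] (p : Seminorm ℂ E) : Type _ :=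
  UniformSpace.Completion (SeminormedCopy p)

/-- The canonical linking map `E_q → E_p` of local Banach spaces, for `p ≤ q`. -/
noncomputable def linkingMap {E : Type*} [AddCommGroup E] [Module ℂ E] (p q : Seminorm ℂ E)
    (h : p ≤ q) : LocalBanachSpace q →L[ℂ] LocalBanachSpace p :=
  (SeminormedCopy.idMap p q h).completion

/-- A (complex, locally convex) space `E` is nuclear if for every continuous seminorm `p` there is a
continuous seminorm `q ≥ p` such that the linking map `E_q → E_p` is nuclear. -/
def IsNuclearLCS (E : Type*) [AddCommGroup E] [Module ℂ E] [TopologicalSpace E] : Prop :=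
  ∀ p : Seminorm ℂ E, Continuous p →
    ∃ (q : Seminorm ℂ E) (h : p ≤ q), Continuous q ∧ IsNuclearMap (linkingMap p q h)

/-! ### Spectra of continuous linear operators

The spectrum `σ(T; X)` is Mathlib's `spectrum ℂ T` in the algebra `X →L[ℂ] X`: the complement of the
set `resolventSet ℂ T` of those `μ` for which `μ I - T` has an inverse in `X →L[ℂ] X`; this inverse
is `resolvent T μ`. -/

section Spectra

variable {X : Type*} [AddCommGroup X] [Module ℂ X] [TopologicalSpace X] [IsTopologicalAddGroup X]
  [ContinuousConstSMul ℂ X]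

/-- The point spectrum of `T`: all `μ` for which `μ I - T` is not injective. -/
def pointSpectrum (T : X →L[ℂ] X) : Set ℂ :=
  {μ | ¬ Function.Injective (μ • ContinuousLinearMap.id ℂ X - T)}

/-- The set `ρ*(T)`: all `μ` such that some open disc around `μ` is contained in the resolvent set
and the resolvents at the points of this disc are equicontinuous (for the translation-invariant
uniform structure of `X`). -/
def resolventSetStar (T : X →L[ℂ] X) : Set ℂ :=
  letI : UniformSpace X := IsTopologicalAddGroup.rightUniformSpace X
  {μ | ∃ δ > 0, Metric.ball μ δ ⊆ resolventSet ℂ T ∧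
    Equicontinuous (fun (z : Metric.ball μ δ) (x : X) => resolvent T (z : ℂ) x)}

/-- The set `σ*(T) = ℂ \ ρ*(T)`. -/
def spectrumStar (T : X →L[ℂ] X) : Set ℂ := (resolventSetStar T)ᶜ

end Spectra

/-! ### Power series spaces of finite type

Sequences are indexed by `ℕ = {0, 1, 2, …}`: the entry with index `n` is the `(n + 1)`-st term. -/

/-- The sequence `α` has its terms in `(1, ∞)`, is strictly increasing and tends to `∞`. -/
structure IsExponentSequence (α : ℕ → ℝ) : Prop where
  one_lt : ∀ n, 1 < α n
  strictMono : StrictMono α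
  tendsto : Tendsto α atTop atTop

/-- The weights `w₁, w₂, …`, where `weight α k` is `w_{k+1}(n) = exp (-αₙ / (k + 1))`. -/
noncomputable def weight (α : ℕ → ℝ) (k n : ℕ) : ℝ := Real.exp (-α n / (k + 1))

theorem weight_pos (α : ℕ → ℝ) (k n : ℕ) : 0 < weight α k n := Real.exp_pos _

/-- The sequences `x` with `w_k(n) |xₙ| → 0` for all `k`. -/
def powerSeriesSubmodule (α : ℕ → ℝ) : Submodule ℂ (ℕ → ℂ) where
  carrier := {x | ∀ k, Tendsto (fun n => weight α k n * ‖x n‖) atTop (𝓝 0)}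
  zero_mem' k := by simp
  add_mem' {x y} hx hy k := by
    refine squeeze_zero (fun n => mul_nonneg (weight_pos α k n).le (norm_nonneg _)) (fun n => ?_)
      (by simpa using (hx k).add (hy k))
    rw [← mul_add]
    exact mul_le_mul_of_nonneg_left (norm_add_le _ _) (weight_pos α k n).le
  smul_mem' c x hx k := by
    have h := (hx k).const_mul ‖c‖
    rw [mul_zero] at h
    refine h.congr fun n => ?_
    simp only [Pi.smul_apply, norm_smul]
    ring

/-- The power series space `Λ₀(α)` of finite type. This is a separate type, so that it carries the
topology of the norms `p_k` below and not that of coordinatewise convergence. -/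
def PowerSeriesSpace (α : ℕ → ℝ) : Type := powerSeriesSubmodule α

namespace PowerSeriesSpace

variable {α : ℕ → ℝ}

noncomputable instance : AddCommGroup (PowerSeriesSpace α) :=
  inferInstanceAs (AddCommGroup (powerSeriesSubmodule α))

noncomputable instance : Module ℂ (PowerSeriesSpace α) :=
  inferInstanceAs (Module ℂ (powerSeriesSubmodule α))

/-- The inclusion of `Λ₀(α)` in the space of all sequences. -/
def toSeq : PowerSeriesSpace α →ₗ[ℂ] (ℕ → ℂ) := (powerSeriesSubmodule α).subtype

theorem toSeq_injective : Function.Injective (toSeq (α := α)) := Subtype.val_injective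

theorem tendsto (x : PowerSeriesSpace α) (k : ℕ) :
    Tendsto (fun n => weight α k n * ‖toSeq x n‖) atTop (𝓝 0) := x.2 k

theorem bddAbove (x : PowerSeriesSpace α) (k : ℕ) :
    BddAbove (Set.range fun n => weight α k n * ‖toSeq x n‖) :=
  (x.tendsto k).bddAbove_range

theorem le_iSup (x : PowerSeriesSpace α) (k n : ℕ) :
    weight α k n * ‖toSeq x n‖ ≤ ⨆ n, weight α k n * ‖toSeq x n‖ :=
  le_ciSup (x.bddAbove k) n

/-- The norms `p_k(x) = supₙ w_k(n) |xₙ|`. -/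
noncomputable def seminorm (α : ℕ → ℝ) : SeminormFamily ℂ (PowerSeriesSpace α) ℕ := fun k =>
  Seminorm.of (fun x => ⨆ n, weight α k n * ‖toSeq x n‖)
    (fun x y => by
      refine ciSup_le fun n => ?_
      refine le_trans ?_ (add_le_add (x.le_iSup k n) (y.le_iSup k n))
      rw [← mul_add, map_add]
      exact mul_le_mul_of_nonneg_left (norm_add_le _ _) (weight_pos α k n).le)
    (fun c x => by
      rw [Real.mul_iSup_of_nonneg (norm_nonneg c)]
      refine iSup_congr fun n => ?_
      rw [map_smul, Pi.smul_apply, norm_smul]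
      ring)

theorem seminorm_apply (k : ℕ) (x : PowerSeriesSpace α) :
    seminorm α k x = ⨆ n, weight α k n * ‖toSeq x n‖ := rfl

/-- The topology of `Λ₀(α)` is the locally convex topology generated by the norms `p_k`. -/
noncomputable instance : TopologicalSpace (PowerSeriesSpace α) :=
  (seminorm α).moduleFilterBasis.topology

theorem withSeminorms (α : ℕ → ℝ) : WithSeminorms (seminorm α) := ⟨rfl⟩

instance : IsTopologicalAddGroup (PowerSeriesSpace α) := (withSeminorms α).topologicalAddGroup

instance : ContinuousSMul ℂ (PowerSeriesSpace α) := (withSeminorms α).continuousSMul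

end PowerSeriesSpace

/-! ### The Cesàro operator -/

/-- The Cesàro operator `(C x)ₙ = (x₁ + ⋯ + xₙ) / n` on all sequences (in the zero-based indexing:
`(C x)ₙ = (x₀ + ⋯ + xₙ) / (n + 1)`). -/
noncomputable def cesaroSeq : (ℕ → ℂ) →ₗ[ℂ] (ℕ → ℂ) where
  toFun x n := (∑ i ∈ Finset.range (n + 1), x i) / ((n : ℂ) + 1)
  map_add' x y := by
    funext n
    simp only [Pi.add_apply, Finset.sum_add_distrib, add_div]
  map_smul' c x := by
    funext n
    simp only [Pi.smul_apply, smul_eq_mul, ← Finset.mul_sum, mul_div_assoc, RingHom.id_apply]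

theorem weight_antitone {α : ℕ → ℝ} (hα : IsExponentSequence α) (k : ℕ) :
    Antitone (weight α k) := by
  intro m n h
  have := hα.strictMono.monotone h
  unfold weight
  gcongr

theorem weight_mul_norm_cesaroSeq_le {α : ℕ → ℝ} (hα : IsExponentSequence α) (k n : ℕ)
    (x : ℕ → ℂ) :
    weight α k n * ‖cesaroSeq x n‖ ≤
      (((n + 1 : ℕ) : ℝ))⁻¹ * ∑ i ∈ Finset.range (n + 1), weight α k i * ‖x i‖ := by
  have h1 : ‖cesaroSeq x n‖ = (((n + 1 : ℕ) : ℝ))⁻¹ * ‖∑ i ∈ Finset.range (n + 1), x i‖ := by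
    have h0 : ‖((n : ℂ) + 1)‖ = ((n + 1 : ℕ) : ℝ) := by
      rw [← Complex.norm_natCast, Nat.cast_add, Nat.cast_one]
    change ‖(∑ i ∈ Finset.range (n + 1), x i) / ((n : ℂ) + 1)‖ = _
    rw [norm_div, h0, div_eq_inv_mul]
  rw [h1, mul_left_comm]
  refine mul_le_mul_of_nonneg_left ?_ (by positivity)
  refine (mul_le_mul_of_nonneg_left (norm_sum_le _ _) (weight_pos α k n).le).trans ?_
  rw [Finset.mul_sum]
  refine Finset.sum_le_sum fun i hi => mul_le_mul_of_nonneg_right ?_ (norm_nonneg _)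
  exact weight_antitone hα k (Nat.lt_succ_iff.mp (Finset.mem_range.mp hi))

theorem cesaroSeq_mem {α : ℕ → ℝ} (hα : IsExponentSequence α) (x : ℕ → ℂ)
    (hx : x ∈ powerSeriesSubmodule α) : cesaroSeq x ∈ powerSeriesSubmodule α := fun k =>
  squeeze_zero (fun n => mul_nonneg (weight_pos α k n).le (norm_nonneg _))
    (fun n => weight_mul_norm_cesaroSeq_le hα k n x)
    ((tendsto_add_atTop_iff_nat 1).mpr (hx k).cesaro)

/-- The Cesàro operator on `Λ₀(α)`, as a linear map. -/
noncomputable def cesaroLin {α : ℕ → ℝ} (hα : IsExponentSequence α) :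
    PowerSeriesSpace α →ₗ[ℂ] PowerSeriesSpace α :=
  cesaroSeq.restrict (p := powerSeriesSubmodule α) (q := powerSeriesSubmodule α) (cesaroSeq_mem hα)

theorem toSeq_cesaroLin {α : ℕ → ℝ} (hα : IsExponentSequence α) (x : PowerSeriesSpace α) :
    (cesaroLin hα x).toSeq = cesaroSeq x.toSeq := rfl

theorem seminorm_cesaroLin_le {α : ℕ → ℝ} (hα : IsExponentSequence α) (k : ℕ)
    (x : PowerSeriesSpace α) :
    PowerSeriesSpace.seminorm α k (cesaroLin hα x) ≤ PowerSeriesSpace.seminorm α k x := by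
  refine ciSup_le fun n => ?_
  rw [toSeq_cesaroLin]
  refine (weight_mul_norm_cesaroSeq_le hα k n _).trans ?_
  rw [inv_mul_le_iff₀ (by positivity)]
  refine (Finset.sum_le_card_nsmul _ _ _ fun i _ => x.le_iSup k i).trans ?_
  rw [Finset.card_range, nsmul_eq_mul, PowerSeriesSpace.seminorm_apply]

/-- The Cesàro operator `C : Λ₀(α) → Λ₀(α)`, a continuous linear operator. -/
noncomputable def cesaro {α : ℕ → ℝ} (hα : IsExponentSequence α) :
    PowerSeriesSpace α →L[ℂ] PowerSeriesSpace α where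
  toLinearMap := cesaroLin hα
  cont := WithSeminorms.continuous_of_isBounded (PowerSeriesSpace.withSeminorms α)
    (PowerSeriesSpace.withSeminorms α) (cesaroLin hα) fun k =>
      ⟨{k}, 1, fun x => by simpa using seminorm_cesaroLin_le hα k x⟩

/-! ### The sets `Σ`, `Σ₀` and the gap `v(α)` -/

/-- The set `Σ = {1/m : m = 1, 2, 3, …}`. -/
def sigmaSet : Set ℂ := {z | ∃ m : ℕ, 1 ≤ m ∧ z = 1 / (m : ℂ)}

/-- The set `Σ₀ = {0} ∪ Σ`. -/
def sigmaZeroSet : Set ℂ := {0} ∪ sigmaSet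

/-- The gap `v(α) = infₙ (αₙ₊₁ - αₙ)`. -/
noncomputable def gap (α : ℕ → ℝ) : ℝ := ⨅ n, (α (n + 1) - α n)

/-! ### Nuclearity forces the weights to be summable -/

/-! Testing a nuclear linking map above `p_k` on the unit vectors, against the functionals `x ↦
w_k(n) xₙ`, shows that every weight is summable. The weights decrease in `n`, so `(n + 1) w_k(n)` is
bounded. Each weight is a power of a later one, so in fact it beats every polynomial
(`exists_pow_mul_weight_le`).

Everything else follows from this decay. On the space of all sequences `z I - C` is lower triangular
with diagonal entries `z - 1/(n + 1)`. For `z ∉ Σ` it is invertible there, and its inverse grows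
only polynomially: `hasPolynomialResolvent_zero` computes it at `z = 0`, and
`hasPolynomialResolvent_of_le` treats `z` away from `Σ₀` by a discrete Gronwall argument. The decay
absorbs polynomial growth at the price of passing from `p_k` to a later norm, so the inverse acts
continuously on `Λ₀(α)`. For `z = 1/(m + 1)` the eigenvector `n ↦ n.choose m` has polynomial growth
and so lies in the space. This gives (i).

For (ii), the growth bounds are uniform on small discs off `Σ₀`, which gives equicontinuity.
Conversely `σ*` always contains the closure of the spectrum, and `0` is a limit of `Σ`. -/

namespace SeminormedCopy

variable {E : Type*} [AddCommGroup E] [Module ℂ E] (p : Seminorm ℂ E)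

/-- The identity of `E`, with values in the seminormed copy of `E`. -/
def toCopy : E →ₗ[ℂ] SeminormedCopy p := LinearMap.id (R := ℂ) (M := E)

theorem norm_toCopy (x : E) : ‖toCopy p x‖ = p x := rfl

theorem idMap_toCopy (q : Seminorm ℂ E) (h : p ≤ q) (x : E) :
    idMap p q h (toCopy q x) = toCopy p x := rfl

end SeminormedCopy

theorem linkingMap_coe {E : Type*} [AddCommGroup E] [Module ℂ E] (p q : Seminorm ℂ E) (h : p ≤ q)
    (x : E) :
    linkingMap p q h (SeminormedCopy.toCopy q x : LocalBanachSpace q) =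
      (SeminormedCopy.toCopy p x : LocalBanachSpace p) := by
  rw [linkingMap, ContinuousLinearMap.completion_apply_coe, SeminormedCopy.idMap_toCopy]

/-- A functional on `E` dominated by `p` extends to the local Banach space at `p`. -/
theorem exists_localBanachSpace_functional {E : Type*} [AddCommGroup E] [Module ℂ E]
    (p : Seminorm ℂ E) (g : E →ₗ[ℂ] ℂ) (hg : ∀ x, ‖g x‖ ≤ p x) :
    ∃ G : LocalBanachSpace p →L[ℂ] ℂ, (∀ y, ‖G y‖ ≤ ‖y‖) ∧
      ∀ x, G (SeminormedCopy.toCopy p x : LocalBanachSpace p) = g x := by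
  let g' : SeminormedCopy p →L[ℂ] ℂ :=
    LinearMap.mkContinuous (show SeminormedCopy p →ₗ[ℂ] ℂ from g) 1
      (fun x => by rw [one_mul]; exact hg x)
  refine ⟨g'.fromCompletion, fun y => ?_, fun x => ?_⟩
  · refine UniformSpace.Completion.induction_on y (isClosed_le (by fun_prop) (by fun_prop))
      fun x => ?_
    rw [ContinuousLinearMap.fromCompletion_apply_coe, UniformSpace.Completion.norm_coe]
    exact hg x
  · rw [ContinuousLinearMap.fromCompletion_apply_coe]
    rfl

/-- If the linking map `E_q → E_p` is nuclear, `(uₙ)` is a sequence whose finite combinations with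
coefficients in the unit disc are bounded for `q`, and `(gₙ)` are functionals dominated by `p`,
then `∑ |gₙ(uₙ)| < ∞`. -/
theorem IsNuclearMap.summable_norm_apply {E : Type*} [AddCommGroup E] [Module ℂ E]
    {p q : Seminorm ℂ E} {h : p ≤ q} (hT : IsNuclearMap (linkingMap p q h))
    (u : ℕ → E) (g : ℕ → E →ₗ[ℂ] ℂ) (hg : ∀ n x, ‖g n x‖ ≤ p x) (C : ℝ)
    (hu : ∀ (s : Finset ℕ) (ε : ℕ → ℂ), (∀ n, ‖ε n‖ ≤ 1) → q (∑ n ∈ s, ε n • u n) ≤ C) :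
    Summable fun n => ‖g n (u n)‖ := by
  obtain ⟨f, y, hfy, hsum⟩ := hT
  choose G hG hGg using fun n => exists_localBanachSpace_functional p (g n) (hg n)
  set U : ℕ → LocalBanachSpace q := fun n => (SeminormedCopy.toCopy q (u n) : LocalBanachSpace q)
    with hU
  have hf : ∀ (s : Finset ℕ) (j : ℕ), ∑ n ∈ s, ‖f j (U n)‖ ≤ C * ‖f j‖ := by
    intro s j
    -- Unimodular `ε n` rotate each value `f j (U n)` onto its modulus, so the sum of moduli is `f
    -- j` at one combination to which `hu` applies.
    choose ε hε hεf using fun n => (RCLike.exists_norm_eq_mul_self (f j (U n)))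
    have h1 : ((∑ n ∈ s, ‖f j (U n)‖ : ℝ) : ℂ) = f j
        ((SeminormedCopy.toCopy q (∑ n ∈ s, ε n • u n) : SeminormedCopy q) :
          LocalBanachSpace q) := by
      have h2 : ((SeminormedCopy.toCopy q (∑ n ∈ s, ε n • u n) : SeminormedCopy q) :
          LocalBanachSpace q) = ∑ n ∈ s, ε n • U n := by
        rw [map_sum, ← UniformSpace.Completion.coe_toComplL (𝕜 := ℂ), map_sum]
        simp only [map_smul]
        rfl
      rw [h2, map_sum, Complex.ofReal_sum]
      refine Finset.sum_congr rfl fun n _ => ?_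
      rw [map_smul, smul_eq_mul]
      exact hεf n
    have h3 : ∑ n ∈ s, ‖f j (U n)‖ = ‖((∑ n ∈ s, ‖f j (U n)‖ : ℝ) : ℂ)‖ := by
      rw [Complex.norm_real, Real.norm_of_nonneg (Finset.sum_nonneg fun _ _ => norm_nonneg _)]
    rw [h3, h1, mul_comm]
    refine (ContinuousLinearMap.le_opNorm _ _).trans
      (mul_le_mul_of_nonneg_left ?_ (norm_nonneg _))
    rw [UniformSpace.Completion.norm_coe, SeminormedCopy.norm_toCopy]
    exact hu s ε fun n => (hε n).le
  have hS : ∀ n, HasSum (fun j => f j (U n) * G n (y j)) (g n (u n)) := by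
    intro n
    have h1 := (hsum (U n)).mapL (G n)
    rw [hU, linkingMap_coe, hGg] at h1
    simpa only [map_smul, smul_eq_mul] using h1
  have hb : ∀ n j, ‖f j (U n) * G n (y j)‖ ≤ ‖f j (U n)‖ * ‖y j‖ := fun n j => by
    rw [norm_mul]
    exact mul_le_mul_of_nonneg_left (hG n _) (norm_nonneg _)
  have hs : ∀ n, Summable fun j => ‖f j (U n)‖ * ‖y j‖ := fun n => by
    refine Summable.of_nonneg_of_le (fun j => by positivity) (fun j => ?_) (hfy.mul_left ‖U n‖)
    rw [← mul_assoc, mul_comm ‖U n‖]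
    exact mul_le_mul_of_nonneg_right (ContinuousLinearMap.le_opNorm _ _) (norm_nonneg _)
  refine summable_of_sum_le (c := ∑' j, C * (‖f j‖ * ‖y j‖)) (fun n => norm_nonneg _) fun s => ?_
  calc ∑ n ∈ s, ‖g n (u n)‖ ≤ ∑ n ∈ s, ∑' j, ‖f j (U n)‖ * ‖y j‖ :=
        Finset.sum_le_sum fun n _ => by
          rw [← (hS n).tsum_eq]
          exact tsum_of_norm_bounded (hs n).hasSum (hb n)
    _ = ∑' j, ∑ n ∈ s, ‖f j (U n)‖ * ‖y j‖ := (Summable.tsum_finsetSum fun n _ => hs n).symm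
    _ ≤ ∑' j, C * (‖f j‖ * ‖y j‖) := by
        refine Summable.tsum_le_tsum (fun j => ?_) (summable_sum fun n _ => hs n) (hfy.mul_left C)
        rw [← Finset.sum_mul, ← mul_assoc]
        exact mul_le_mul_of_nonneg_right (hf s j) (norm_nonneg _)

theorem weight_le_one {α : ℕ → ℝ} (hα : IsExponentSequence α) (k n : ℕ) : weight α k n ≤ 1 := by
  refine Real.exp_le_one_iff.mpr ?_
  have := hα.one_lt n
  exact div_nonpos_of_nonpos_of_nonneg (by linarith) (by positivity)

namespace PowerSeriesSpace

variable {α : ℕ → ℝ}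

/-- A sequence in the power series submodule, as an element of the power series space. -/
def ofSeq (x : ℕ → ℂ) (hx : x ∈ powerSeriesSubmodule α) : PowerSeriesSpace α := ⟨x, hx⟩

theorem toSeq_ofSeq (x : ℕ → ℂ) (hx : x ∈ powerSeriesSubmodule α) : toSeq (ofSeq x hx) = x := rfl

theorem single_mem (n : ℕ) : Pi.single n (1 : ℂ) ∈ powerSeriesSubmodule α := fun k => by
  refine tendsto_const_nhds.congr' ?_
  filter_upwards [eventually_gt_atTop n] with m hm
  rw [Pi.single_eq_of_ne hm.ne', norm_zero, mul_zero]

/-- The unit vectors of the power series space. -/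
def single (n : ℕ) : PowerSeriesSpace α := ofSeq (Pi.single n 1) (single_mem n)

theorem seminorm_le {k : ℕ} {x : PowerSeriesSpace α} {M : ℝ}
    (h : ∀ n, weight α k n * ‖toSeq x n‖ ≤ M) : seminorm α k x ≤ M :=
  ciSup_le h

theorem continuous_seminorm (k : ℕ) : Continuous (seminorm α k) :=
  (withSeminorms α).continuous_seminorm k

/-- Entries and weights are both at most 1. The bound depends on neither `k` nor `s`, so a finite
maximum of the norms, and hence any continuous seminorm, is bounded on these combinations. -/
theorem seminorm_sum_single_le (hα : IsExponentSequence α) (k : ℕ) (s : Finset ℕ) (ε : ℕ → ℂ)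
    (hε : ∀ n, ‖ε n‖ ≤ 1) : seminorm α k (∑ n ∈ s, ε n • single n) ≤ 1 := by
  refine seminorm_le fun i => ?_
  have h : ‖toSeq (∑ n ∈ s, ε n • single (α := α) n) i‖ ≤ 1 := by
    simp only [map_sum, map_smul, single, toSeq_ofSeq, Finset.sum_apply, Pi.smul_apply,
      Pi.single_apply, smul_eq_mul, mul_ite, mul_one, mul_zero, Finset.sum_ite_eq]
    split_ifs
    · exact hε i
    · simp
  exact mul_le_one₀ (weight_le_one hα k i) (norm_nonneg _) h

theorem summable_weight (hα : IsExponentSequence α) (hnuc : IsNuclearLCS (PowerSeriesSpace α))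
    (k : ℕ) : Summable (weight α k) := by
  obtain ⟨q, h, hq, hT⟩ := hnuc (seminorm α k) (continuous_seminorm k)
  obtain ⟨s, C, -, hC⟩ := Seminorm.bound_of_continuous (withSeminorms α) q hq
  let g : ℕ → PowerSeriesSpace α →ₗ[ℂ] ℂ := fun n =>
    (weight α k n : ℂ) • (LinearMap.proj n ∘ₗ toSeq)
  have hg : ∀ n x, g n x = weight α k n * toSeq x n := fun n x => rfl
  have hw : ∀ n, ‖(weight α k n : ℂ)‖ = weight α k n := fun n => by
    rw [Complex.norm_real, Real.norm_of_nonneg (weight_pos α k n).le]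
  refine (hT.summable_norm_apply single g (fun n x => ?_) C fun t ε hε => ?_).congr fun n => ?_
  · rw [hg, norm_mul, hw]
    exact x.le_iSup k n
  · refine (hC _).trans ?_
    rw [smul_apply, NNReal.smul_def, smul_eq_mul]
    refine mul_le_of_le_one_right C.2 (Seminorm.finset_sup_apply_le zero_le_one fun l _ => ?_)
    exact seminorm_sum_single_le hα l t ε hε
  · rw [hg, norm_mul, hw, single, toSeq_ofSeq, Pi.single_eq_same, norm_one, mul_one]

end PowerSeriesSpace

/-- The index `l` stands for the exponent `-αₙ / (l + 1)`, so the new index must satisfy `l + 1 = (m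
+ 1) (k + 1)`. -/
theorem weight_eq_pow (α : ℕ → ℝ) (k m n : ℕ) :
    weight α k n = weight α ((m + 1) * (k + 1) - 1) n ^ (m + 1) := by
  have h : 1 ≤ (m + 1) * (k + 1) := Nat.succ_le_of_lt (by positivity)
  unfold weight
  rw [← Real.exp_nat_mul]
  push_cast [h]
  congr 1
  field_simp
  ring

/-- If all the weights are summable, then they decay faster than any polynomial. -/
theorem exists_pow_mul_weight_le {α : ℕ → ℝ} (hα : IsExponentSequence α)
    (hs : ∀ k, Summable (weight α k)) (k m : ℕ) :
    ∃ M : ℝ, 0 ≤ M ∧ ∀ n : ℕ, ((n : ℝ) + 2) ^ m * weight α k n ≤ M := by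
  set l := (m + 1) * (k + 1) - 1 with hl
  -- Each of the `m + 1` factors `w_l(n)` pays for one factor `n + 2 ≤ 2 (n + 1)`.
  refine ⟨(2 * ∑' n, weight α l n) ^ (m + 1),
    pow_nonneg (mul_nonneg two_pos.le (tsum_nonneg fun n => (weight_pos α l n).le)) _, fun n => ?_⟩
  have h1 : ((n : ℝ) + 1) * weight α l n ≤ ∑' n, weight α l n := by
    refine le_trans ?_ ((hs l).sum_le_tsum (Finset.range (n + 1)) fun i _ => (weight_pos α l i).le)
    have := Finset.card_nsmul_le_sum (Finset.range (n + 1)) (weight α l) (weight α l n)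
      fun i hi => weight_antitone hα l (Nat.lt_succ_iff.mp (Finset.mem_range.mp hi))
    simpa using this
  have h2 : ((n : ℝ) + 2) * weight α l n ≤ 2 * ∑' n, weight α l n := by
    have := weight_pos α l n
    have hn : (0 : ℝ) ≤ n := n.cast_nonneg
    nlinarith
  calc ((n : ℝ) + 2) ^ m * weight α k n ≤ ((n : ℝ) + 2) ^ (m + 1) * weight α k n := by
        refine mul_le_mul_of_nonneg_right ?_ (weight_pos α k n).le
        exact pow_le_pow_right₀ (by linarith [n.cast_nonneg (α := ℝ)]) m.le_succ
    _ = (((n : ℝ) + 2) * weight α l n) ^ (m + 1) := by rw [mul_pow, weight_eq_pow α k m n]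
    _ ≤ _ := pow_le_pow_left₀ (mul_nonneg (by positivity) (weight_pos α l n).le) h2 _

/-! ### The resolvent equation on sequences -/

/-- `z I - C` is surjective on the space of all sequences, and its inverse grows polynomially with
constant `A` and degree `m`. -/
structure HasPolynomialResolvent (A : ℝ) (m : ℕ) (z : ℂ) : Prop where
  surjective : ∀ y : ℕ → ℂ, ∃ x : ℕ → ℂ, z • x - cesaroSeq x = y
  norm_le : ∀ (x : ℕ → ℂ) (n : ℕ) (B : ℝ), (∀ i ≤ n, ‖(z • x - cesaroSeq x) i‖ ≤ B) →
    ‖x n‖ ≤ A * ((n : ℝ) + 2) ^ m * B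

theorem cesaroSeq_apply (x : ℕ → ℂ) (n : ℕ) :
    cesaroSeq x n = (∑ i ∈ Finset.range (n + 1), x i) / ((n : ℂ) + 1) := rfl

theorem natCast_add_one_mul_cesaroSeq (x : ℕ → ℂ) (n : ℕ) :
    ((n : ℂ) + 1) * cesaroSeq x n = ∑ i ∈ Finset.range (n + 1), x i :=
  mul_div_cancel₀ _ n.cast_add_one_ne_zero

theorem hasPolynomialResolvent_zero : HasPolynomialResolvent 2 1 0 where
  surjective y := by
    -- The equation `-C x = y` prescribes the partial sums of `x`; their differences give `x`. At `n
    -- = 0` the truncated index `n - 1` is harmless, since its factor `n` vanishes.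
    refine ⟨fun n => -(((n : ℂ) + 1) * y n - n * y (n - 1)), ?_⟩
    have h : ∀ n : ℕ, ∑ i ∈ Finset.range n, -(((i : ℂ) + 1) * y i - i * y (i - 1)) =
        -(n * y (n - 1)) := by
      intro n
      induction n with
      | zero => simp
      | succ n ih =>
        rw [Finset.sum_range_succ, ih, Nat.add_sub_cancel]
        push_cast
        ring
    funext n
    rw [zero_smul, zero_sub, Pi.neg_apply, cesaroSeq_apply, h, Nat.add_sub_cancel]
    have := n.cast_add_one_ne_zero (R := ℂ)
    push_cast
    field_simp
  norm_le x n B h := by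
    simp only [zero_smul, zero_sub, Pi.neg_apply, norm_neg] at h
    have hB : 0 ≤ B := (norm_nonneg _).trans (h n le_rfl)
    have hs : ∀ i ≤ n, ‖∑ j ∈ Finset.range (i + 1), x j‖ ≤ ((i : ℝ) + 1) * B := fun i hi => by
      rw [← natCast_add_one_mul_cesaroSeq, norm_mul]
      refine mul_le_mul ?_ (h i hi) (norm_nonneg _) (by positivity)
      rw [← Nat.cast_add_one, Complex.norm_natCast, Nat.cast_add_one]
    rw [pow_one]
    rcases n with _ | n
    · have := hs 0 le_rfl
      simp only [zero_add, Finset.sum_range_one, Nat.cast_zero, one_mul] at this ⊢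
      linarith
    · have h1 := hs (n + 1) le_rfl
      have h2 := hs n n.le_succ
      have h3 : x (n + 1) =
          ∑ j ∈ Finset.range (n + 1 + 1), x j - ∑ j ∈ Finset.range (n + 1), x j := by
        rw [Finset.sum_range_succ, add_sub_cancel_left]
      rw [h3]
      refine (norm_sub_le _ _).trans ((add_le_add h1 h2).trans ?_)
      push_cast
      nlinarith

/-- With `t n` the sum of the first `n` entries of `x`, the equation reads `(z - 1/(n+1)) xₙ =
tₙ/(n+1) + yₙ`. It can be solved recursively, and it gives `|tₙ₊₁| ≤ (1 + K/(n+1)) |tₙ| + K B`,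
whose solutions grow polynomially. -/
theorem hasPolynomialResolvent_of_le (K : ℕ) (z : ℂ)
    (h : ∀ n : ℕ, 1 ≤ K * ‖z - 1 / ((n : ℂ) + 1)‖) :
    HasPolynomialResolvent (K + K ^ 2) K z := by
  have hz : ∀ n : ℕ, z - 1 / ((n : ℂ) + 1) ≠ 0 := fun n h0 => by
    have := h n
    rw [h0, norm_zero, mul_zero] at this
    linarith
  have hn : ∀ n : ℕ, (n : ℂ) + 1 ≠ 0 := fun n => n.cast_add_one_ne_zero
  refine ⟨fun y => ?_, fun x n B hB => ?_⟩
  · let t : ℕ → ℂ := fun n => Nat.rec 0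
      (fun n t => t + (t / ((n : ℂ) + 1) + y n) / (z - 1 / ((n : ℂ) + 1))) n
    have ht : ∀ n, t (n + 1) = t n + (t n / ((n : ℂ) + 1) + y n) / (z - 1 / ((n : ℂ) + 1)) :=
      fun n => rfl
    refine ⟨fun n => t (n + 1) - t n, ?_⟩
    funext n
    rw [Pi.sub_apply, Pi.smul_apply, cesaroSeq_apply, Finset.sum_range_sub, smul_eq_mul]
    have h1 : (z - 1 / ((n : ℂ) + 1)) * (t (n + 1) - t n) = t n / ((n : ℂ) + 1) + y n := by
      rw [ht, add_sub_cancel_left, mul_div_cancel₀ _ (hz n)]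
    have h0 : t 0 = 0 := rfl
    rw [h0, sub_zero]
    linear_combination h1
  · set y := z • x - cesaroSeq x with hy
    set t : ℕ → ℂ := fun n => ∑ i ∈ Finset.range n, x i with ht
    have hB0 : 0 ≤ B := (norm_nonneg _).trans (hB n le_rfl)
    have hx : ∀ i ≤ n, ‖x i‖ ≤ K * (‖t i‖ / ((i : ℝ) + 1) + B) := fun i hi => by
      have h1 : (z - 1 / ((i : ℂ) + 1)) * x i = t i / ((i : ℂ) + 1) + y i := by
        rw [hy, Pi.sub_apply, Pi.smul_apply, cesaroSeq_apply, Finset.sum_range_succ, smul_eq_mul]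
        ring
      have h2 : ‖(z - 1 / ((i : ℂ) + 1))‖ * ‖x i‖ ≤ ‖t i‖ / ((i : ℝ) + 1) + B := by
        rw [← norm_mul, h1]
        refine (norm_add_le _ _).trans (add_le_add (le_of_eq ?_) (hB i hi))
        rw [norm_div, ← Nat.cast_add_one, Complex.norm_natCast, Nat.cast_add_one]
      calc ‖x i‖ ≤ (K * ‖z - 1 / ((i : ℂ) + 1)‖) * ‖x i‖ :=
            le_mul_of_one_le_left (norm_nonneg _) (h i)
        _ = K * (‖z - 1 / ((i : ℂ) + 1)‖ * ‖x i‖) := mul_assoc _ _ _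
        _ ≤ _ := mul_le_mul_of_nonneg_left h2 K.cast_nonneg
    have htb : ∀ i ≤ n, ‖t i‖ ≤ K * i * ((i : ℝ) + 1) ^ K * B := by
      intro i
      induction i with
      | zero => simp [ht]
      | succ i ih =>
        intro hi
        have hi' : i ≤ n := i.le_succ.trans hi
        have hp : (0 : ℝ) < (i : ℝ) + 1 := by positivity
        have h1 : t (i + 1) = t i + x i := Finset.sum_range_succ _ _
        -- Bernoulli's inequality replaces the growth factor by `((i+2)/(i+1))^K`, whose product
        -- telescopes.
        have h2 : 1 + K / ((i : ℝ) + 1) ≤ (1 + 1 / ((i : ℝ) + 1)) ^ K := by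
          have := one_add_mul_le_pow (a := 1 / ((i : ℝ) + 1))
            (le_trans (by norm_num) (one_div_pos.mpr hp).le) K
          rwa [mul_one_div] at this
        have h3 : (1 + 1 / ((i : ℝ) + 1)) ^ K * ((i : ℝ) + 1) ^ K = ((i : ℝ) + 2) ^ K := by
          rw [← mul_pow]
          congr 1
          field_simp
          ring
        have h4 : (1 : ℝ) ≤ ((i : ℝ) + 2) ^ K :=
          one_le_pow₀ (by linarith)
        calc ‖t (i + 1)‖ ≤ ‖t i‖ + K * (‖t i‖ / ((i : ℝ) + 1) + B) := by
              rw [h1]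
              exact (norm_add_le _ _).trans (add_le_add_right (hx i hi') _)
          _ = (1 + K / ((i : ℝ) + 1)) * ‖t i‖ + K * B := by ring
          _ ≤ (1 + 1 / ((i : ℝ) + 1)) ^ K * (K * i * ((i : ℝ) + 1) ^ K * B) + K * B :=
              add_le_add_left (mul_le_mul h2 (ih hi') (norm_nonneg _) (by positivity)) _
          _ = K * i * B * ((1 + 1 / ((i : ℝ) + 1)) ^ K * ((i : ℝ) + 1) ^ K) + K * B * 1 := by ring
          _ ≤ K * i * B * ((i : ℝ) + 2) ^ K + K * B * ((i : ℝ) + 2) ^ K := by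
              rw [h3]
              exact add_le_add_right (mul_le_mul_of_nonneg_left h4 (by positivity)) _
          _ = _ := by
              push_cast
              ring
    have hp : (0 : ℝ) < (n : ℝ) + 1 := by positivity
    have h1 : ‖t n‖ / ((n : ℝ) + 1) ≤ K * ((n : ℝ) + 2) ^ K * B := by
      rw [div_le_iff₀ hp]
      refine (htb n le_rfl).trans ?_
      have : ((n : ℝ) + 1) ^ K ≤ ((n : ℝ) + 2) ^ K :=
        pow_le_pow_left₀ hp.le (by linarith) K
      calc (K : ℝ) * n * ((n : ℝ) + 1) ^ K * B = K * B * (((n : ℝ) + 1) ^ K * n) := by ring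
        _ ≤ K * B * (((n : ℝ) + 2) ^ K * (n + 1)) := by
          refine mul_le_mul_of_nonneg_left ?_ (by positivity)
          exact mul_le_mul this (by linarith) (by positivity) (by positivity)
        _ = _ := by ring
    have h2 : (1 : ℝ) ≤ ((n : ℝ) + 2) ^ K := one_le_pow₀ (by linarith)
    calc ‖x n‖ ≤ K * (K * ((n : ℝ) + 2) ^ K * B + 1 * B) :=
          (hx n le_rfl).trans (mul_le_mul_of_nonneg_left
            (add_le_add h1 (one_mul B).ge) K.cast_nonneg)
      _ ≤ K * (K * ((n : ℝ) + 2) ^ K * B + ((n : ℝ) + 2) ^ K * B) := by gcongr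
      _ = _ := by ring

/-! ### The resolvent on the power series space -/

section Resolvent

open PowerSeriesSpace

variable {α : ℕ → ℝ} {A : ℝ} {m : ℕ} {z : ℂ}

/-- The weight `w_k` is split as `w_l ^ 2`: one factor is kept to absorb the polynomial, the other
bounds `y`. As `w_l` decreases, `|yᵢ| ≤ p_l(y) / w_l(n)` for all `i ≤ n`, and the entry `xₙ` depends
on no later `yᵢ`. -/
theorem weight_mul_norm_le_of_resolvent_equation (hα : IsExponentSequence α)
    (hz : HasPolynomialResolvent A m z) {x : ℕ → ℂ} {y : PowerSeriesSpace α}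
    (hxy : z • x - cesaroSeq x = toSeq y) (k n : ℕ) :
    weight α k n * ‖x n‖ ≤ A * (((n : ℝ) + 2) ^ m * weight α ((1 + 1) * (k + 1) - 1) n) *
      seminorm α ((1 + 1) * (k + 1) - 1) y := by
  rw [weight_eq_pow α k 1 n]
  set l := (1 + 1) * (k + 1) - 1
  have hw := weight_pos α l n
  have h1 := hz.norm_le x n (seminorm α l y / weight α l n) fun i hi => by
    rw [hxy, le_div_iff₀ hw, mul_comm]
    exact (mul_le_mul_of_nonneg_right (weight_antitone hα l hi) (norm_nonneg _)).trans
      (y.le_iSup l i)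
  refine (mul_le_mul_of_nonneg_left h1 (by positivity)).trans (le_of_eq ?_)
  field_simp
  ring

theorem tendsto_pow_mul_weight (hα : IsExponentSequence α) (hs : ∀ k, Summable (weight α k))
    (k m : ℕ) : Tendsto (fun n : ℕ => ((n : ℝ) + 2) ^ m * weight α k n) atTop (𝓝 0) := by
  obtain ⟨M, -, hM⟩ := exists_pow_mul_weight_le hα hs k (m + 1)
  have h1 : Tendsto (fun n : ℕ => M / ((n : ℝ) + 2)) atTop (𝓝 0) :=
    (tendsto_atTop_add_const_right _ _ tendsto_natCast_atTop_atTop).const_div_atTop M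
  refine squeeze_zero (fun n => mul_nonneg (by positivity) (weight_pos α k n).le) (fun n => ?_) h1
  rw [le_div_iff₀ (by positivity)]
  calc ((n : ℝ) + 2) ^ m * weight α k n * (n + 2) = ((n : ℝ) + 2) ^ (m + 1) * weight α k n := by
        ring
    _ ≤ M := hM n

/-- Sequences of polynomial growth belong to the power series space. -/
theorem mem_powerSeriesSubmodule_of_norm_le_pow (hα : IsExponentSequence α)
    (hs : ∀ k, Summable (weight α k)) {x : ℕ → ℂ} (h : ∀ n, ‖x n‖ ≤ ((n : ℝ) + 2) ^ m) :
    x ∈ powerSeriesSubmodule α := fun k =>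
  squeeze_zero (fun n => mul_nonneg (weight_pos α k n).le (norm_nonneg _))
    (fun n => by
      rw [mul_comm]
      exact mul_le_mul_of_nonneg_right (h n) (weight_pos α k n).le)
    (tendsto_pow_mul_weight hα hs k m)

theorem mem_of_resolvent_equation (hα : IsExponentSequence α) (hs : ∀ k, Summable (weight α k))
    (hz : HasPolynomialResolvent A m z) {x : ℕ → ℂ} {y : PowerSeriesSpace α}
    (hxy : z • x - cesaroSeq x = toSeq y) : x ∈ powerSeriesSubmodule α := fun k => by
  refine squeeze_zero (fun n => mul_nonneg (weight_pos α k n).le (norm_nonneg _))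
    (fun n => weight_mul_norm_le_of_resolvent_equation hα hz hxy k n) ?_
  simpa using ((tendsto_pow_mul_weight hα hs ((1 + 1) * (k + 1) - 1) m).const_mul A).mul_const
    (seminorm α ((1 + 1) * (k + 1) - 1) y)

theorem toSeq_smul_sub_cesaro (hα : IsExponentSequence α) (z : ℂ) (x : PowerSeriesSpace α) :
    toSeq ((algebraMap ℂ (PowerSeriesSpace α →L[ℂ] PowerSeriesSpace α) z - cesaro hα) x) =
      z • toSeq x - cesaroSeq (toSeq x) := rfl

/-- The constant sees `z` only through `A` and `m`. The estimate therefore serves both for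
continuity of one inverse and for equicontinuity over a disc. -/
theorem seminorm_le_of_resolvent_equation (hα : IsExponentSequence α)
    (hz : HasPolynomialResolvent A m z) (hA : 0 ≤ A) {k : ℕ} {M : ℝ}
    (hM : ∀ n : ℕ, ((n : ℝ) + 2) ^ m * weight α ((1 + 1) * (k + 1) - 1) n ≤ M)
    (x : PowerSeriesSpace α) :
    seminorm α k x ≤ A * M * seminorm α ((1 + 1) * (k + 1) - 1)
      ((algebraMap ℂ (PowerSeriesSpace α →L[ℂ] PowerSeriesSpace α) z - cesaro hα) x) :=
  seminorm_le fun n => (weight_mul_norm_le_of_resolvent_equation hα hz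
    (toSeq_smul_sub_cesaro hα z x).symm k n).trans <|
      mul_le_mul_of_nonneg_right (mul_le_mul_of_nonneg_left (hM n) hA) (apply_nonneg _ _)

theorem HasPolynomialResolvent.mem_resolventSet (hα : IsExponentSequence α)
    (hs : ∀ k, Summable (weight α k)) (hz : HasPolynomialResolvent A m z) (hA : 0 ≤ A) :
    z ∈ resolventSet ℂ (cesaro hα) := by
  set T := algebraMap ℂ (PowerSeriesSpace α →L[ℂ] PowerSeriesSpace α) z - cesaro hα with hT
  have hinj : Function.Injective T.toLinearMap := by
    rw [← LinearMap.ker_eq_bot, LinearMap.ker_eq_bot']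
    intro x hx
    refine toSeq_injective (funext fun n => ?_)
    have h1 : z • toSeq x - cesaroSeq (toSeq x) = 0 := by
      rw [← toSeq_smul_sub_cesaro hα]
      exact (congrArg toSeq hx).trans (map_zero _)
    -- The growth bound with `B = 0` is injectivity.
    have h2 := hz.norm_le (toSeq x) n 0 fun i _ => by
      rw [h1, Pi.zero_apply, norm_zero]
    rw [mul_zero] at h2
    rw [norm_le_zero_iff.mp h2, map_zero, Pi.zero_apply]
  have hsurj : Function.Surjective T.toLinearMap := fun y => by
    obtain ⟨x, hx⟩ := hz.surjective (toSeq y)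
    refine ⟨ofSeq x (mem_of_resolvent_equation hα hs hz hx), toSeq_injective ?_⟩
    exact (toSeq_smul_sub_cesaro hα z _).trans hx
  let e := LinearEquiv.ofBijective T.toLinearMap ⟨hinj, hsurj⟩
  have he : ∀ y, T (e.symm y) = y := fun y => e.apply_symm_apply y
  let R : PowerSeriesSpace α →L[ℂ] PowerSeriesSpace α :=
    { toLinearMap := e.symm.toLinearMap
      cont := WithSeminorms.continuous_of_isBounded (withSeminorms α) (withSeminorms α) _ fun k => by
        obtain ⟨M, hM0, hM⟩ := exists_pow_mul_weight_le hα hs ((1 + 1) * (k + 1) - 1) m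
        refine ⟨{(1 + 1) * (k + 1) - 1}, ⟨A * M, mul_nonneg hA hM0⟩, fun y => ?_⟩
        have h1 := seminorm_le_of_resolvent_equation hα hz hA hM (e.symm y)
        rw [← hT, he] at h1
        rw [Finset.sup_singleton]
        exact h1 }
  refine ⟨⟨T, R, ?_, ?_⟩, rfl⟩
  · ext1 y
    exact he y
  · ext1 x
    exact e.symm_apply_apply x

theorem HasPolynomialResolvent.seminorm_resolvent_le (hα : IsExponentSequence α)
    (hs : ∀ k, Summable (weight α k)) (hz : HasPolynomialResolvent A m z) (hA : 0 ≤ A)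
    {k : ℕ} {M : ℝ} (hM : ∀ n : ℕ, ((n : ℝ) + 2) ^ m * weight α ((1 + 1) * (k + 1) - 1) n ≤ M)
    (y : PowerSeriesSpace α) :
    seminorm α k (resolvent (cesaro hα) z y) ≤
      A * M * seminorm α ((1 + 1) * (k + 1) - 1) y := by
  -- `resolvent` is a `Ring.inverse`, which is zero at non-units, so membership in the resolvent set
  -- is needed first.
  have h1 := Ring.mul_inverse_cancel _ (hz.mem_resolventSet hα hs hA)
  have h2 := seminorm_le_of_resolvent_equation hα hz hA hM (resolvent (cesaro hα) z y)
  have h3 : (algebraMap ℂ (PowerSeriesSpace α →L[ℂ] PowerSeriesSpace α) z - cesaro hα)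
      (resolvent (cesaro hα) z y) = y := DFunLike.congr_fun h1 y
  rwa [h3] at h2

end Resolvent

/-! ### The sets `Σ` and `Σ₀` -/

theorem one_div_mem_sigmaSet (n : ℕ) : 1 / ((n : ℂ) + 1) ∈ sigmaSet :=
  ⟨n + 1, n.succ_pos, by push_cast; rfl⟩

theorem sigmaSet_eq_range : sigmaSet = Set.range fun n : ℕ => 1 / ((n : ℂ) + 1) := by
  ext z
  refine ⟨?_, fun ⟨n, hn⟩ => hn ▸ one_div_mem_sigmaSet n⟩
  rintro ⟨m, hm, rfl⟩
  exact ⟨m - 1, by push_cast [hm]; ring⟩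

theorem closure_sigmaSet : closure sigmaSet = sigmaZeroSet := by
  have ht : Tendsto (fun n : ℕ => 1 / ((n : ℂ) + 1)) atTop (𝓝 0) :=
    tendsto_one_div_add_atTop_nhds_zero_nat
  refine Set.Subset.antisymm ?_ ?_
  · refine closure_minimal Set.subset_union_right ?_
    rw [sigmaZeroSet, sigmaSet_eq_range, Set.singleton_union]
    exact ht.isCompact_insert_range.isClosed
  · refine Set.union_subset (Set.singleton_subset_iff.mpr ?_) subset_closure
    exact mem_closure_of_tendsto ht (Eventually.of_forall one_div_mem_sigmaSet)

theorem isClosed_sigmaZeroSet : IsClosed sigmaZeroSet := closure_sigmaSet ▸ isClosed_closure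

/-- Away from `Σ₀` the resolvents of the Cesàro operator grow polynomially, locally uniformly. -/
theorem exists_ball_hasPolynomialResolvent {z₀ : ℂ} (h : z₀ ∉ sigmaZeroSet) :
    ∃ δ > 0, ∃ K : ℕ, ∀ z ∈ Metric.ball z₀ δ, HasPolynomialResolvent (K + K ^ 2) K z := by
  obtain ⟨r, hr, hball⟩ := Metric.isOpen_iff.mp isClosed_sigmaZeroSet.isOpen_compl z₀ h
  -- Points within `r / 2` of `z₀` keep distance at least `r / 2` from `Σ`, which makes `K ≥ 2 / r`
  -- suffice.
  obtain ⟨K, hK⟩ := exists_nat_ge (2 / r)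
  refine ⟨r / 2, half_pos hr, K, fun z hz => hasPolynomialResolvent_of_le K z fun n => ?_⟩
  have h1 : r / 2 ≤ ‖z - 1 / ((n : ℂ) + 1)‖ := by
    by_contra! h2
    refine hball (a := 1 / ((n : ℂ) + 1)) ?_ (Or.inr (one_div_mem_sigmaSet n))
    rw [← dist_eq_norm, dist_comm] at h2
    have := dist_triangle (1 / ((n : ℂ) + 1)) z z₀
    rw [Metric.mem_ball] at hz ⊢
    linarith
  calc (1 : ℝ) = 2 / r * (r / 2) := by field_simp
    _ ≤ K * ‖z - 1 / ((n : ℂ) + 1)‖ := mul_le_mul hK h1 (half_pos hr).le K.cast_nonneg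

/-! ### Spectra -/

theorem pointSpectrum_subset_spectrum {X : Type*} [AddCommGroup X] [Module ℂ X]
    [TopologicalSpace X] [IsTopologicalAddGroup X] [ContinuousConstSMul ℂ X] (T : X →L[ℂ] X) :
    pointSpectrum T ⊆ spectrum ℂ T := by
  intro μ hμ h
  obtain ⟨u, hu⟩ := h
  refine hμ (Function.LeftInverse.injective (g := u⁻¹.1) fun x => ?_)
  have h1 : μ • ContinuousLinearMap.id ℂ X - T = u := hu.symm
  rw [h1]
  exact DFunLike.congr_fun u.inv_mul x

/-- A point of `ρ*` has a whole disc free of spectrum. This is what puts `0` into `σ*` of the Cesàro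
operator, although `0` itself lies in the resolvent set. -/
theorem closure_spectrum_subset_spectrumStar {X : Type*} [AddCommGroup X] [Module ℂ X]
    [TopologicalSpace X] [IsTopologicalAddGroup X] [ContinuousConstSMul ℂ X] (T : X →L[ℂ] X) :
    closure (spectrum ℂ T) ⊆ spectrumStar T := by
  rintro μ hμ ⟨δ, hδ, hball, -⟩
  obtain ⟨w, hw, hd⟩ := Metric.mem_closure_iff.mp hμ δ hδ
  exact hw (hball (Metric.mem_ball'.mpr hd))

open PowerSeriesSpace

variable {α : ℕ → ℝ}

/-- The binomial sequence `n ↦ n.choose m` is an eigenvector with eigenvalue `1 / (m + 1)`. -/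
theorem cesaroSeq_choose (m : ℕ) :
    cesaroSeq (fun n => (n.choose m : ℂ)) = (1 / ((m : ℂ) + 1)) • fun n => (n.choose m : ℂ) := by
  funext n
  -- The hockey-stick identity; the terms with `i < m` vanish.
  have h1 : ∑ i ∈ Finset.range (n + 1), i.choose m = (n + 1).choose (m + 1) := by
    rw [← Nat.sum_Icc_choose]
    refine (Finset.sum_subset (fun i hi => ?_) fun i hi hi' => Nat.choose_eq_zero_of_lt ?_).symm
    · simp only [Finset.mem_Icc, Finset.mem_range] at *
      omega
    · simp only [Finset.mem_Icc, Finset.mem_range] at *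
      omega
  have h2 : ((n : ℂ) + 1) * n.choose m = (n + 1).choose (m + 1) * ((m : ℂ) + 1) := by
    exact_mod_cast n.add_one_mul_choose_eq m
  have hn := n.cast_add_one_ne_zero (R := ℂ)
  have hm := m.cast_add_one_ne_zero (R := ℂ)
  rw [cesaroSeq_apply, ← Nat.cast_sum, h1, Pi.smul_apply, smul_eq_mul, div_eq_iff hn]
  field_simp
  linear_combination -h2

theorem sigmaSet_subset_pointSpectrum (hα : IsExponentSequence α)
    (hs : ∀ k, Summable (weight α k)) : sigmaSet ⊆ pointSpectrum (cesaro hα) := by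
  rw [sigmaSet_eq_range]
  rintro _ ⟨m, rfl⟩ hinj
  have hmem : (fun n : ℕ => (n.choose m : ℂ)) ∈ powerSeriesSubmodule α := by
    refine mem_powerSeriesSubmodule_of_norm_le_pow (m := m) hα hs fun n => ?_
    rw [Complex.norm_natCast]
    calc (n.choose m : ℝ) ≤ (n : ℝ) ^ m := by exact_mod_cast Nat.choose_le_pow n m
      _ ≤ _ := pow_le_pow_left₀ n.cast_nonneg (by linarith) m
  -- Injectivity would annihilate the eigenvector, but its entry at `m` is `m.choose m = 1`.
  have h1 : toSeq (ofSeq _ hmem) m = 0 := by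
    rw [hinj (a₁ := ofSeq _ hmem) (a₂ := 0), map_zero, Pi.zero_apply]
    rw [map_zero]
    refine toSeq_injective ((toSeq_smul_sub_cesaro hα _ _).trans ?_)
    rw [toSeq_ofSeq, cesaroSeq_choose, sub_self, map_zero]
  rw [toSeq_ofSeq, Nat.choose_self, Nat.cast_one] at h1
  exact one_ne_zero h1

theorem spectrum_cesaro_subset_sigmaSet (hα : IsExponentSequence α)
    (hs : ∀ k, Summable (weight α k)) : spectrum ℂ (cesaro hα) ⊆ sigmaSet := by
  intro z hz
  by_contra hzs
  refine hz ?_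
  by_cases h0 : z = 0
  · rw [h0]
    exact hasPolynomialResolvent_zero.mem_resolventSet hα hs two_pos.le
  · have h1 : z ∉ sigmaZeroSet := fun h => h.elim h0 hzs
    obtain ⟨δ, hδ, K, hK⟩ := exists_ball_hasPolynomialResolvent h1
    exact (hK z (Metric.mem_ball_self hδ)).mem_resolventSet hα hs (by positivity)

theorem spectrumStar_cesaro_subset_sigmaZeroSet (hα : IsExponentSequence α)
    (hs : ∀ k, Summable (weight α k)) : spectrumStar (cesaro hα) ⊆ sigmaZeroSet := by
  intro z₀ hz₀
  by_contra h
  refine hz₀ ?_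
  obtain ⟨δ, hδ, K, hK⟩ := exists_ball_hasPolynomialResolvent h
  have hA : (0 : ℝ) ≤ K + K ^ 2 := by positivity
  refine ⟨δ, hδ, fun z hz => (hK z hz).mem_resolventSet hα hs hA, ?_⟩
  let _ : UniformSpace (PowerSeriesSpace α) := IsTopologicalAddGroup.rightUniformSpace _
  have : IsUniformAddGroup (PowerSeriesSpace α) := isUniformAddGroup_of_addCommGroup
  -- Equicontinuity in seminorm form: for each `k`, one continuous seminorm must dominate `p_k ∘
  -- R(z)` for all `z` in the disc. A multiple of `p_l` does, as `K` is common to the disc.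
  refine (((withSeminorms α).equicontinuous_TFAE fun z : Metric.ball z₀ δ =>
    (resolvent (cesaro hα) (z : ℂ)).toLinearMap).out 1 3).mpr fun k => ?_
  obtain ⟨M, hM0, hM⟩ := exists_pow_mul_weight_le hα hs ((1 + 1) * (k + 1) - 1) K
  let c : NNReal := ⟨_, mul_nonneg hA hM0⟩
  refine ⟨c • seminorm α ((1 + 1) * (k + 1) - 1),
    (continuous_seminorm _).const_smul _, fun z y => ?_⟩
  exact (hK z z.2).seminorm_resolvent_le hα hs hA hM y

theorem proposition2 (α : ℕ → ℝ) (hα : IsExponentSequence α)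
    (hnuc : IsNuclearLCS (PowerSeriesSpace α)) :
    (spectrum ℂ (cesaro hα) = pointSpectrum (cesaro hα) ∧
      pointSpectrum (cesaro hα) = sigmaSet) ∧
    (0 < gap α →
      spectrumStar (cesaro hα) = closure (spectrum ℂ (cesaro hα)) ∧
      closure (spectrum ℂ (cesaro hα)) = sigmaZeroSet) := by
  have hs := summable_weight hα hnuc
  have h1 := pointSpectrum_subset_spectrum (cesaro hα)
  have h2 := sigmaSet_subset_pointSpectrum hα hs
  have h3 := spectrum_cesaro_subset_sigmaSet hα hs
  have hcl : closure (spectrum ℂ (cesaro hα)) = sigmaZeroSet := by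
    rw [h3.antisymm (h2.trans h1), closure_sigmaSet]
  refine ⟨⟨(h3.trans h2).antisymm h1, (h1.trans h3).antisymm h2⟩, fun _ => ⟨?_, hcl⟩⟩
  refine Set.Subset.antisymm ?_ (closure_spectrum_subset_spectrumStar _)
  rw [hcl]
  exact spectrumStar_cesaro_subset_sigmaZeroSet hα hs
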